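/- Let $V:(0,\infty)\to\mathbb R$ be a measurable function that is not almost everywhere zero, with $\int_0^\infty |V(x)|\,dx<\infty$ and $\int_0^\infty x|V(x)|\,dx<\infty$. For $\sigma>0$ let $H$ be the operator in $L^2(0,\infty)$ given by $$H\psi=-\psi''-\sigma V\psi,\qquad \psi'(0)=0,$$ on the domain of all $\psi\in L^2(0,\infty)$ that are continuously differentiable on $[0,\infty)$, with $\psi'$ absolutely continuous on every interval $[0,b]$, $\psi'(0)=0$, and $-\psi''-\sigma V\psi\in L^2(0,\infty)$. If $\int_0^\infty V(x)\,dx\ge 0$, then for every $\sigma>0$ the operator $H$ has a negative eigenvalue $\lambda=\lambda(\sigma)<0$. -/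

import Mathlib

noncomputable section

namespace HalfLine

open MeasureTheory Set

/-- Lebesgue measure on the open half-line `(0, ∞)`. -/
abbrev halfLineMeasure : Measure ℝ := volume.restrict (Ioi (0 : ℝ))

/-- The complex Hilbert space `L²(0, ∞)`. -/
abbrev L2 : Type := Lp ℂ 2 halfLineMeasure

/-- `f` and `g` in `L²(0, ∞)` satisfy: `f` has a representative `ψ` that is continuously
differentiable on `[0, ∞)`, its derivative `dψ` is absolutely continuous on every `[0, b]`,
`dψ 0 = 0` (Neumann condition), and `g = -ψ'' - σ V ψ` almost everywhere on `(0, ∞)`. -/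
def IsSchrodingerPair (V : ℝ → ℝ) (σ : ℝ) (f g : L2) : Prop :=
  ∃ ψ dψ d2ψ : ℝ → ℂ,
    (∀ᵐ x ∂halfLineMeasure, f x = ψ x) ∧
    (∀ x ∈ Ici (0 : ℝ), HasDerivWithinAt ψ (dψ x) (Ici 0) x) ∧
    (∀ b : ℝ, 0 < b → AbsolutelyContinuousOnInterval dψ 0 b) ∧
    dψ 0 = 0 ∧
    (∀ᵐ x ∂halfLineMeasure, HasDerivAt dψ (d2ψ x) x) ∧
    (∀ᵐ x ∂halfLineMeasure, g x = -d2ψ x - (σ : ℂ) * (V x : ℂ) * ψ x)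

/-- The graph of the Neumann operator `ψ ↦ -ψ'' - σ V ψ` with its maximal domain. -/
def neumannGraph (V : ℝ → ℝ) (σ : ℝ) : Submodule ℂ (L2 × L2) where
  carrier := {p | IsSchrodingerPair V σ p.1 p.2}
  zero_mem' := by
    refine ⟨0, 0, 0, ?_, ?_, ?_, rfl, ?_, ?_⟩
    · filter_upwards [Lp.coeFn_zero ℂ 2 halfLineMeasure] with x hx using hx
    · intro x _
      exact hasDerivWithinAt_const x _ (0 : ℂ)
    · intro b _
      exact (LipschitzWith.const (0 : ℂ)).lipschitzOnWith.absolutelyContinuousOnInterval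
    · exact Filter.Eventually.of_forall fun x => hasDerivAt_const x (0 : ℂ)
    · filter_upwards [Lp.coeFn_zero ℂ 2 halfLineMeasure] with x hx
      simpa using hx
  add_mem' := by
    rintro ⟨f₁, g₁⟩ ⟨f₂, g₂⟩ ⟨ψ₁, dψ₁, eψ₁, hf₁, h₁, hac₁, h0₁, hd₁, hg₁⟩
      ⟨ψ₂, dψ₂, eψ₂, hf₂, h₂, hac₂, h0₂, hd₂, hg₂⟩
    refine ⟨ψ₁ + ψ₂, dψ₁ + dψ₂, eψ₁ + eψ₂, ?_, ?_, ?_, ?_, ?_, ?_⟩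
    · filter_upwards [Lp.coeFn_add f₁ f₂, hf₁, hf₂] with x hx hx₁ hx₂
      simp only [Prod.fst_add, hx, Pi.add_apply]
      rw [← hx₁, ← hx₂]
    · intro x hx
      exact (h₁ x hx).add (h₂ x hx)
    · intro b hb
      exact (hac₁ b hb).add (hac₂ b hb)
    · simp [h0₁, h0₂]
    · filter_upwards [hd₁, hd₂] with x hx₁ hx₂ using hx₁.add hx₂
    · filter_upwards [Lp.coeFn_add g₁ g₂, hg₁, hg₂] with x hx hx₁ hx₂
      simp only [Prod.snd_add, hx, Pi.add_apply]
      rw [hx₁, hx₂]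
      ring
  smul_mem' := by
    rintro c ⟨f, g⟩ ⟨ψ, dψ, eψ, hf, h, hac, h0, hd, hg⟩
    refine ⟨c • ψ, c • dψ, c • eψ, ?_, ?_, ?_, ?_, ?_, ?_⟩
    · filter_upwards [Lp.coeFn_smul c f, hf] with x hx hx₁
      simp only [Prod.smul_fst, hx, Pi.smul_apply]
      rw [← hx₁]
    · intro x hx
      exact (h x hx).const_smul c
    · intro b hb
      exact (hac b hb).const_smul c
    · simp [h0]
    · filter_upwards [hd] with x hx using hx.const_smul c
    · filter_upwards [Lp.coeFn_smul c g, hg] with x hx hx₁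
      simp only [Prod.smul_snd, hx, Pi.smul_apply, smul_eq_mul]
      rw [hx₁]
      ring

/-- The graph is single-valued. -/
theorem neumannGraph_single_valued (V : ℝ → ℝ) (σ : ℝ) (p : L2 × L2)
    (hp : p ∈ neumannGraph V σ) (hp1 : p.1 = 0) : p.2 = 0 := by
  obtain ⟨f, g⟩ := p
  obtain ⟨ψ, dψ, eψ, hf, h, hac, h0, hd, hg⟩ := hp
  simp only at hp1 hf hg ⊢
  subst hp1
  have hae : ∀ᵐ x ∂halfLineMeasure, ψ x = (0 : ℝ → ℂ) x := by
    filter_upwards [hf, Lp.coeFn_zero ℂ 2 halfLineMeasure] with x hx hx₀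
    rw [← hx, hx₀]
  have hcont : ContinuousOn ψ (Ioi 0) := fun x hx =>
    ((h x (Ioi_subset_Ici_self hx)).continuousWithinAt).mono Ioi_subset_Ici_self
  have hψ : EqOn ψ 0 (Ioi 0) :=
    Measure.eqOn_open_of_ae_eq hae isOpen_Ioi hcont continuousOn_const
  have hdψ : EqOn dψ 0 (Ioi 0) := by
    intro x hx
    have h1 : HasDerivAt ψ (dψ x) x := (h x (Ioi_subset_Ici_self hx)).hasDerivAt (Ici_mem_nhds hx)
    have h2 : HasDerivAt ψ 0 x :=
      (hasDerivAt_const x (0 : ℂ)).congr_of_eventuallyEq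
        (hψ.eventuallyEq_of_mem (Ioi_mem_nhds hx))
    exact h1.unique h2
  apply Lp.ext
  filter_upwards [hd, hg, Lp.coeFn_zero ℂ 2 halfLineMeasure,
    ae_restrict_mem measurableSet_Ioi] with x hx hgx hx₀ hxpos
  have h2 : HasDerivAt dψ 0 x :=
    (hasDerivAt_const x (0 : ℂ)).congr_of_eventuallyEq
      (hdψ.eventuallyEq_of_mem (Ioi_mem_nhds hxpos))
  rw [hgx, hx₀, hx.unique h2, hψ hxpos]
  simp

/-- The operator `H ψ = -ψ'' - σ V ψ` in `L²(0, ∞)` with Neumann condition `ψ'(0) = 0`. -/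
def neumannOperator (V : ℝ → ℝ) (σ : ℝ) : L2 →ₗ.[ℂ] L2 :=
  (neumannGraph V σ).toLinearPMap

/-- `H f = g` (with `f` in the domain) means exactly that `(f, g)` is a Schrödinger pair. -/
theorem mem_graph_neumannOperator (V : ℝ → ℝ) (σ : ℝ) (f g : L2) :
    (f, g) ∈ (neumannOperator V σ).graph ↔ IsSchrodingerPair V σ f g := by
  rw [neumannOperator, Submodule.toLinearPMap_graph_eq _ (neumannGraph_single_valued V σ)]
  rfl

/-- `μ` is an eigenvalue of the (unbounded) operator `T`. -/
def IsEigenvalue {E : Type*} [AddCommGroup E] [Module ℂ E] (T : E →ₗ.[ℂ] E) (μ : ℂ) : Prop :=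
  ∃ f : T.domain, (f : E) ≠ 0 ∧ T f = μ • (f : E)

end HalfLine

end

/-!
The eigenvalue is found among the Jost solutions of `f'' = (q + κ²) f`, where `q` is `-σV` on
`(0, ∞)`: for each `κ ≥ 0` there is a solution `f = exp (-κx) m(κ, x)` whose amplitude `m` tends to
`1` at infinity. For `κ > 0` it is square integrable, so `-κ²` is an eigenvalue as soon as
`f'(0) = 0`, that is `m'(0) = κ m(0)`.

The amplitudes solve the Volterra equation `m(x) = 1 + ∫ₓ^∞ D_κ(t - x) q(t) m(t) dt` with
`D_κ(y) = ∫₀^y exp (-2κs) ds`. As `D_κ(y) ≤ y`, finiteness of `∫ t|q(t)| dt` makes the right-hand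
side a contraction in a supremum norm weighted by `exp (2 ∫ₓ^∞ t|q(t)| dt)`
(`IsBargmannPotential.contracting_volterraMap`). The fixed point is taken among bounded continuous
functions of the pair `(κ, x)`, which gives joint continuity down to `κ = 0`. The properties used
later are collected in `IsJostFamily`.

Suppose `f'(0) ≠ 0` for all `κ > 0`. For large `κ` the amplitude is close to `1`, so `f > 0` and
`f'(0) < 0`; by continuity `f'(0) < 0` for all `κ > 0`. The minimum of the amplitude over the
half-line depends continuously on `κ`, and it never vanishes: a zero in the interior would be a
double zero, a zero at the origin would force `f'(0) ≥ 0`, and near infinity `m` is close to `1`.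
Hence `f > 0` for all `κ > 0` (`IsJostFamily.amplitude_pos_of_ne`). In the limit `κ → 0` the
zero-energy solution `f` is positive with `f'(0) ≤ 0`. Its logarithmic derivative satisfies
`u' = q - u²` and tends to `0` at infinity, so `∫ u² = ∫ q + u(0) ≤ 0` when `∫ V ≥ 0`. Thus `u = 0`
and `q = 0` almost everywhere (`IsJostFamily.ae_eq_zero_of_amplitude_pos`), contrary to the
assumption on `V`.
-/

open MeasureTheory Set Filter Topology
open scoped NNReal BoundedContinuousFunction

/-! ### Absolutely continuous functions -/

theorem LipschitzOnWith.comp_absolutelyContinuousOnInterval {X Y : Type*} [PseudoMetricSpace X]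
    [PseudoMetricSpace Y] {g : X → Y} {s : Set X} {K : ℝ≥0} {f : ℝ → X} {a b : ℝ}
    (hg : LipschitzOnWith K g s) (hf : AbsolutelyContinuousOnInterval f a b)
    (hs : MapsTo f (uIcc a b) s) : AbsolutelyContinuousOnInterval (g ∘ f) a b := by
  have hK := Tendsto.const_mul (K : ℝ) hf
  rw [mul_zero] at hK
  refine squeeze_zero' (Eventually.of_forall fun _ ↦ Finset.sum_nonneg fun i _ ↦ dist_nonneg) ?_ hK
  rw [eventually_inf_principal]
  filter_upwards with (n, I) hnI
  rw [Finset.mul_sum]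
  refine Finset.sum_le_sum fun i hi ↦ ?_
  exact hg.dist_le_mul _ (hs (hnI.left i hi).left) _ (hs (hnI.left i hi).right)

theorem AbsolutelyContinuousOnInterval.exp {f : ℝ → ℝ} {a b : ℝ}
    (hf : AbsolutelyContinuousOnInterval f a b) :
    AbsolutelyContinuousOnInterval (fun x ↦ Real.exp (f x)) a b := by
  obtain ⟨C, hC⟩ := hf.exists_bound
  obtain ⟨K, hK⟩ := (Real.contDiff_exp (n := 1)).contDiffOn.exists_lipschitzOnWith (by decide)
    (convex_Icc (-C) C) isCompact_Icc
  exact hK.comp_absolutelyContinuousOnInterval hf fun x hx ↦ abs_le.1 (hC x hx)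

theorem AbsolutelyContinuousOnInterval.integral_eq_sub_of_ae_hasDerivAt {f f' : ℝ → ℝ} {a b : ℝ}
    (hab : a ≤ b) (hf : AbsolutelyContinuousOnInterval f a b)
    (h : ∀ᵐ x, x ∈ Ioc a b → HasDerivAt f (f' x) x) :
    ∫ x in a..b, f' x = f b - f a := by
  rw [← hf.integral_deriv_eq_sub]
  refine intervalIntegral.integral_congr_ae ?_
  filter_upwards [h] with x hx hxab
  rw [uIoc_of_le hab] at hxab
  exact (hx hxab).deriv.symm

theorem AbsolutelyContinuousOnInterval.le_of_ae_hasDerivAt_nonpos {f f' : ℝ → ℝ} {a b : ℝ}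
    (hab : a ≤ b) (hf : AbsolutelyContinuousOnInterval f a b)
    (h : ∀ᵐ x, x ∈ Ioc a b → HasDerivAt f (f' x) x) (h' : ∀ x ∈ Ioc a b, f' x ≤ 0) :
    f b ≤ f a := by
  have h1 := hf.integral_eq_sub_of_ae_hasDerivAt hab h
  rw [intervalIntegral.integral_of_le hab] at h1
  have h2 := setIntegral_nonpos (μ := volume) measurableSet_Ioc h'
  linarith

theorem absolutelyContinuousOnInterval_of_hasDerivAt {f f' : ℝ → ℝ} (h : ∀ x, HasDerivAt f (f' x) x)
    (hf' : Continuous f') (a b : ℝ) : AbsolutelyContinuousOnInterval f a b := by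
  have hd : deriv f = f' := funext fun x ↦ (h x).deriv
  have : ContDiff ℝ 1 f := contDiff_one_iff_deriv.2
    ⟨fun x ↦ (h x).differentiableAt, hd ▸ hf'⟩
  exact this.contDiffOn.absolutelyContinuousOnInterval

/-! ### The tail of an integral -/

theorem integral_Ioi_eq_sub {g : ℝ → ℝ} (hg : Integrable g) (a x : ℝ) :
    ∫ t in Ioi x, g t = (∫ t in Ioi a, g t) - ∫ t in a..x, g t := by
  rw [← intervalIntegral.integral_Ioi_sub_Ioi' hg.integrableOn hg.integrableOn]
  ring

theorem tendsto_integral_Ioi_atTop {g : ℝ → ℝ} (hg : Integrable g) :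
    Tendsto (fun x ↦ ∫ t in Ioi x, g t) atTop (𝓝 0) := by
  have h := (intervalIntegral_tendsto_integral_Ioi 0 hg.integrableOn tendsto_id).const_sub
    (∫ t in Ioi 0, g t)
  rw [sub_self] at h
  exact h.congr fun x ↦ (integral_Ioi_eq_sub hg 0 x).symm

theorem ae_hasDerivAt_integral_Ioi {g : ℝ → ℝ} (hg : Integrable g) :
    ∀ᵐ x, HasDerivAt (fun x ↦ ∫ t in Ioi x, g t) (-g x) x := by
  filter_upwards [LocallyIntegrable.ae_hasDerivAt_integral hg.locallyIntegrable] with x hx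
  simpa [funext (integral_Ioi_eq_sub hg 0)] using (hx 0).const_sub (∫ t in Ioi 0, g t)

theorem absolutelyContinuousOnInterval_integral_Ioi {g : ℝ → ℝ} (hg : Integrable g) (a b : ℝ) :
    AbsolutelyContinuousOnInterval (fun x ↦ ∫ t in Ioi x, g t) a b := by
  have h := (hg.intervalIntegrable (a := a) (b := b)).absolutelyContinuousOnInterval_intervalIntegral
    (c := a) left_mem_uIcc
  have hc : AbsolutelyContinuousOnInterval (fun _ : ℝ ↦ ∫ t in Ioi a, g t) a b :=
    (LipschitzWith.const _).lipschitzOnWith.absolutelyContinuousOnInterval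
  simpa only [funext (integral_Ioi_eq_sub hg a)] using hc.fun_sub h

theorem continuous_integral_Ioi {g : ℝ → ℝ} (hg : Integrable g) :
    Continuous fun x ↦ ∫ t in Ioi x, g t := by
  simp only [funext (integral_Ioi_eq_sub hg 0)]
  exact continuous_const.sub (intervalIntegral.continuous_primitive (fun _ _ ↦ hg.intervalIntegrable) 0)

/-- With `Q(x) = ∫ₓ^∞ g`, the function `g exp (2Q)` is minus half the derivative of `exp (2Q)`, so its
integral over `(x, ∞)` is at most `exp (2Q(x)) / 2`. -/
theorem exp_two_mul_integral_Ioi_le {g : ℝ → ℝ} (hg : Integrable g) (h0 : ∀ t, 0 ≤ g t) (x : ℝ) :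
    Integrable (fun t ↦ g t * Real.exp (2 * ∫ s in Ioi t, g s)) ∧
    ∫ t in Ioi x, g t * Real.exp (2 * ∫ s in Ioi t, g s) ≤
      Real.exp (2 * ∫ s in Ioi x, g s) / 2 := by
  set Q : ℝ → ℝ := fun t ↦ ∫ s in Ioi t, g s with hQ
  have hQc : Continuous Q := continuous_integral_Ioi hg
  have hQb (t : ℝ) : Q t ≤ ∫ s, g s := setIntegral_le_integral hg (Eventually.of_forall h0)
  have hint : Integrable fun t ↦ g t * Real.exp (2 * Q t) := by
    refine hg.mul_bdd (c := Real.exp (2 * ∫ s, g s)) (by fun_prop) (Eventually.of_forall fun t ↦ ?_)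
    rw [Real.norm_eq_abs, Real.abs_exp, Real.exp_le_exp]
    linarith [hQb t]
  refine ⟨hint, ?_⟩
  have key (b : ℝ) (hb : x ≤ b) :
      ∫ t in x..b, g t * Real.exp (2 * Q t) ≤ Real.exp (2 * Q x) / 2 := by
    have hac := ((absolutelyContinuousOnInterval_integral_Ioi hg x b).const_mul 2).exp.const_mul
      (-(1 / 2))
    rw [hac.integral_eq_sub_of_ae_hasDerivAt hb]
    · have := Real.exp_pos (2 * Q b)
      simp only [hQ] at this ⊢
      linarith
    · filter_upwards [ae_hasDerivAt_integral_Ioi hg] with t ht _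
      convert! ((ht.const_mul 2).exp.const_mul (-(1 / 2))) using 1
      ring
  refine le_of_tendsto (intervalIntegral_tendsto_integral_Ioi x hint.integrableOn tendsto_id) ?_
  filter_upwards [eventually_ge_atTop x] with b hb using key b hb

/-! ### The damped ramp -/

/-- The function `y ↦ ∫₀^y exp (-2κs) ds`, which is `(1 - exp (-2κy)) / (2κ)` for `κ ≠ 0` and `y`
for `κ = 0`. The kernel of the Volterra equation for the Jost solutions is `dampedRamp κ (t - x)`. -/
noncomputable def dampedRamp (κ y : ℝ) : ℝ := ∫ s in 0..y, Real.exp (-(2 * κ * s))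

theorem dampedRamp_zero (κ : ℝ) : dampedRamp κ 0 = 0 := by simp [dampedRamp]

theorem continuous_dampedRamp : Continuous fun z : ℝ × ℝ ↦ dampedRamp z.1 z.2 := by
  refine intervalIntegral.continuous_parametric_intervalIntegral_of_continuous
    (f := fun (z : ℝ × ℝ) s ↦ Real.exp (-(2 * z.1 * s))) ?_ continuous_snd
  unfold Function.uncurry
  fun_prop

theorem hasDerivAt_dampedRamp (κ y : ℝ) :
    HasDerivAt (dampedRamp κ) (Real.exp (-(2 * κ * y))) y :=
  intervalIntegral.integral_hasDerivAt_right (Continuous.intervalIntegrable (by fun_prop) _ _)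
    (Continuous.stronglyMeasurableAtFilter (by fun_prop) _ _) (by fun_prop)

theorem dampedRamp_nonneg (κ : ℝ) {y : ℝ} (hy : 0 ≤ y) : 0 ≤ dampedRamp κ y :=
  intervalIntegral.integral_nonneg hy fun _ _ ↦ (Real.exp_pos _).le

/-- The damped ramp is `1`-Lipschitz on `[0, ∞)`, uniformly in `κ ≥ 0`. -/
theorem dampedRamp_sub_le {κ : ℝ} (hκ : 0 ≤ κ) {x y : ℝ} (hx : 0 ≤ x) (hy : 0 ≤ y) :
    |dampedRamp κ y - dampedRamp κ x| ≤ |y - x| := by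
  have h := (convex_Ici (0 : ℝ)).norm_image_sub_le_of_norm_hasDerivWithin_le
    (f := dampedRamp κ) (C := 1) (fun z _ ↦ (hasDerivAt_dampedRamp κ z).hasDerivWithinAt)
    (fun z hz ↦ ?_) hx hy
  · simpa using h
  · rw [Real.norm_eq_abs, Real.abs_exp, Real.exp_le_one_iff]
    have : 0 ≤ κ * z := mul_nonneg hκ hz
    linarith

theorem dampedRamp_le {κ : ℝ} (hκ : 0 ≤ κ) {y : ℝ} (hy : 0 ≤ y) : dampedRamp κ y ≤ y := by
  have := dampedRamp_sub_le hκ le_rfl hy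
  rw [dampedRamp_zero, sub_zero, sub_zero, abs_of_nonneg hy] at this
  exact (le_abs_self _).trans this

theorem two_mul_mul_dampedRamp_le_one (κ : ℝ) (y : ℝ) : 2 * κ * dampedRamp κ y ≤ 1 := by
  have h : ∫ s in 0..y, 2 * κ * Real.exp (-(2 * κ * s)) = 1 - Real.exp (-(2 * κ * y)) := by
    have := intervalIntegral.integral_eq_sub_of_hasDerivAt
      (f := fun s ↦ -Real.exp (-(2 * κ * s))) (f' := fun s ↦ 2 * κ * Real.exp (-(2 * κ * s)))
      (a := 0) (b := y) (fun s _ ↦ ?_) (Continuous.intervalIntegrable (by fun_prop) _ _)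
    · rw [this]; simp; ring
    · convert! (((hasDerivAt_id s).const_mul (2 * κ)).neg.exp.neg) using 1
      simp; ring
  rw [intervalIntegral.integral_const_mul] at h
  have := Real.exp_pos (-(2 * κ * y))
  unfold dampedRamp
  linarith

/-! ### The Volterra equation for the Jost amplitude -/

/-- A potential on the half-line, extended by zero to the whole line, that is integrable together
with its first moment. -/
structure IsBargmannPotential (q : ℝ → ℝ) : Prop where
  integrable : Integrable q
  integrable_moment : Integrable fun t ↦ t * q t
  eq_zero_of_nonpos : ∀ t ≤ 0, q t = 0

namespace IsBargmannPotential

variable {q : ℝ → ℝ}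

theorem integrable_abs_moment (hq : IsBargmannPotential q) : Integrable fun t ↦ |t * q t| :=
  hq.integrable_moment.abs

theorem abs_kernel_le (q : ℝ → ℝ) {κ x : ℝ} (hκ : 0 ≤ κ) (hx : 0 ≤ x) (t c : ℝ) :
    |dampedRamp κ (max (t - x) 0) * (q t * c)| ≤ (Ioi x).indicator (fun t ↦ |t * q t| * |c|) t := by
  rcases le_or_gt t x with h | h
  · rw [max_eq_right (by linarith), dampedRamp_zero, zero_mul, abs_zero,
      indicator_of_notMem (by simpa using h)]
  · rw [max_eq_left (by linarith), indicator_of_mem (by simpa using h), abs_mul, abs_mul, abs_mul,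
      mul_assoc, abs_of_nonneg (dampedRamp_nonneg κ (by linarith)), abs_of_nonneg (hx.trans h.le)]
    gcongr
    exact (dampedRamp_le hκ (by linarith)).trans (by linarith)

/-- The weight `exp (2 ∫ₓ^∞ |t q(t)| dt)`, relative to which the Volterra operator is a contraction
with constant `1/2`. -/
noncomputable def weight (q : ℝ → ℝ) (x : ℝ) : ℝ := Real.exp (2 * ∫ t in Ioi x, |t * q t|)

theorem weight_pos (q : ℝ → ℝ) (x : ℝ) : 0 < weight q x := Real.exp_pos _

theorem one_le_weight (q : ℝ → ℝ) (x : ℝ) : 1 ≤ weight q x := by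
  refine Real.one_le_exp ?_
  have := setIntegral_nonneg (μ := volume) (measurableSet_Ioi (a := x))
    (fun t _ ↦ abs_nonneg (t * q t))
  positivity

theorem weight_le (hq : IsBargmannPotential q) (x : ℝ) :
    weight q x ≤ Real.exp (2 * ∫ t, |t * q t|) := by
  refine Real.exp_le_exp.2 ?_
  have := setIntegral_le_integral (s := Ioi x) hq.integrable_abs_moment
    (Eventually.of_forall fun t ↦ abs_nonneg _)
  linarith

theorem continuous_weight (hq : IsBargmannPotential q) : Continuous (weight q) :=
  Real.continuous_exp.comp ((continuous_integral_Ioi hq.integrable_abs_moment).const_mul 2)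

theorem integrable_moment_mul_weight (hq : IsBargmannPotential q) :
    Integrable fun t ↦ |t * q t| * weight q t :=
  (exp_two_mul_integral_Ioi_le hq.integrable_abs_moment (fun _ ↦ abs_nonneg _) 0).1

theorem setIntegral_moment_mul_weight_le (hq : IsBargmannPotential q) (x : ℝ) :
    ∫ t in Ioi x, |t * q t| * weight q t ≤ weight q x / 2 :=
  (exp_two_mul_integral_Ioi_le hq.integrable_abs_moment (fun _ ↦ abs_nonneg _) x).2

theorem aestronglyMeasurable_kernel (hq : IsBargmannPotential q) (κ x : ℝ) {c : ℝ → ℝ}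
    (hc : Continuous c) :
    AEStronglyMeasurable (fun t ↦ dampedRamp κ (max (t - x) 0) * (q t * c t)) := by
  have h1 : Continuous fun t : ℝ ↦ dampedRamp κ (max (t - x) 0) :=
    continuous_dampedRamp.comp (by fun_prop : Continuous fun t : ℝ ↦ (κ, max (t - x) 0))
  exact h1.aestronglyMeasurable.mul (hq.integrable.1.mul hc.aestronglyMeasurable)

theorem abs_weighted_kernel_le (q : ℝ → ℝ) {κ x : ℝ} (hκ : 0 ≤ κ) (hx : 0 ≤ x)
    {n : ℝ → ℝ} {C : ℝ} (hn : ∀ t, |n t| ≤ C) (t : ℝ) :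
    |dampedRamp κ (max (t - x) 0) * (q t * (weight q t * n t))| ≤
      (Ioi x).indicator (fun t ↦ |t * q t| * weight q t * C) t := by
  refine (abs_kernel_le q hκ hx t _).trans (indicator_le_indicator ?_)
  rw [abs_mul (weight q t), abs_of_pos (weight_pos q t), ← mul_assoc]
  have := weight_pos q t
  gcongr
  exact hn t

theorem integrable_weighted_kernel (hq : IsBargmannPotential q) {κ x : ℝ} (hκ : 0 ≤ κ) (hx : 0 ≤ x)
    {n : ℝ → ℝ} (hnc : Continuous n) {C : ℝ} (hn : ∀ t, |n t| ≤ C) :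
    Integrable fun t ↦ dampedRamp κ (max (t - x) 0) * (q t * (weight q t * n t)) :=
  ((hq.integrable_moment_mul_weight.mul_const C).indicator measurableSet_Ioi).mono'
    (hq.aestronglyMeasurable_kernel κ x (hq.continuous_weight.mul hnc))
    (Eventually.of_forall (abs_weighted_kernel_le q hκ hx hn))

theorem abs_integral_weighted_kernel_le (hq : IsBargmannPotential q) {κ x : ℝ} (hκ : 0 ≤ κ)
    (hx : 0 ≤ x) {n : ℝ → ℝ} {C : ℝ} (hC : 0 ≤ C) (hn : ∀ t, |n t| ≤ C) :
    |∫ t, dampedRamp κ (max (t - x) 0) * (q t * (weight q t * n t))| ≤ weight q x / 2 * C := by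
  rw [← Real.norm_eq_abs]
  refine (norm_integral_le_of_norm_le
    ((hq.integrable_moment_mul_weight.mul_const C).indicator measurableSet_Ioi)
    (Eventually.of_forall (abs_weighted_kernel_le q hκ hx hn))).trans ?_
  rw [integral_indicator measurableSet_Ioi, integral_mul_const]
  gcongr
  exact hq.setIntegral_moment_mul_weight_le x

/-- The Volterra operator of the Jost amplitude, conjugated by the weight. The parameter `κ` is a
variable of the functions acted on, so that a fixed point is jointly continuous in `(κ, x)`; the
position `x` is truncated at `0`. -/
noncomputable def volterraMap (hq : IsBargmannPotential q) (n : (ℝ≥0 × ℝ) →ᵇ ℝ) :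
    (ℝ≥0 × ℝ) →ᵇ ℝ :=
  BoundedContinuousFunction.ofNormedAddCommGroup
    (fun z ↦ (weight q (max z.2 0))⁻¹ *
      (1 + ∫ t, dampedRamp z.1 (max (t - max z.2 0) 0) * (q t * (weight q t * n (z.1, t)))))
    (by
      refine Continuous.mul ((hq.continuous_weight.comp (by fun_prop)).inv₀
        fun _ ↦ (weight_pos q _).ne') (continuous_const.add ?_)
      refine continuous_of_dominated (bound := fun t ↦ |t * q t| * weight q t * ‖n‖)
        (fun z ↦ hq.aestronglyMeasurable_kernel _ _ (hq.continuous_weight.mul (by fun_prop)))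
        (fun z ↦ Eventually.of_forall fun t ↦ ?_) (hq.integrable_moment_mul_weight.mul_const _)
        (Eventually.of_forall fun t ↦ ?_)
      · refine (abs_weighted_kernel_le q z.1.coe_nonneg (le_max_right _ _)
          (n := fun t ↦ n (z.1, t)) (fun t ↦ n.norm_coe_le_norm _) t).trans
          (indicator_le_self' (fun s _ ↦ ?_) t)
        have := weight_pos q s
        positivity
      · refine Continuous.mul (continuous_dampedRamp.comp
          (by fun_prop : Continuous fun z : ℝ≥0 × ℝ ↦ ((z.1 : ℝ), max (t - max z.2 0) 0))) ?_
        fun_prop)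
    (1 + ‖n‖)
    (by
      intro z
      have hw := weight_pos q (max z.2 0)
      have h1 := one_le_weight q (max z.2 0)
      have h := hq.abs_integral_weighted_kernel_le z.1.coe_nonneg (le_max_right z.2 0) (norm_nonneg n)
        (n := fun t ↦ n (z.1, t)) (fun t ↦ n.norm_coe_le_norm _)
      rw [norm_mul, norm_inv, Real.norm_eq_abs, abs_of_pos hw, inv_mul_le_iff₀ hw]
      refine (norm_add_le _ _).trans ?_
      rw [norm_one, Real.norm_eq_abs]
      refine (add_le_add_right h 1).trans ?_
      have : ‖n‖ ≤ weight q (max z.2 0) * ‖n‖ := le_mul_of_one_le_left (norm_nonneg n) h1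
      linarith [norm_nonneg n])

theorem contracting_volterraMap (hq : IsBargmannPotential q) :
    ContractingWith (1 / 2) hq.volterraMap := by
  refine ⟨by norm_num, LipschitzWith.of_dist_le_mul fun n n' ↦ ?_⟩
  rw [BoundedContinuousFunction.dist_le (by positivity)]
  intro z
  have hw := weight_pos q (max z.2 0)
  have hz : (0 : ℝ) ≤ z.1 := z.1.coe_nonneg
  have hx : 0 ≤ max z.2 0 := le_max_right _ _
  have h := hq.abs_integral_weighted_kernel_le hz hx (C := dist n n') dist_nonneg
    (n := fun t ↦ n (z.1, t) - n' (z.1, t))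
    (fun t ↦ by rw [← Real.dist_eq]; exact BoundedContinuousFunction.dist_coe_le_dist _)
  have hi (n : (ℝ≥0 × ℝ) →ᵇ ℝ) := hq.integrable_weighted_kernel hz hx
    (n := fun t ↦ n (z.1, t)) (by fun_prop) (fun t ↦ n.norm_coe_le_norm (z.1, t))
  simp only [mul_sub] at h
  rw [integral_sub (hi n) (hi n')] at h
  change dist ((weight q (max z.2 0))⁻¹ * _) ((weight q (max z.2 0))⁻¹ * _) ≤ _
  rw [Real.dist_eq, ← mul_sub, abs_mul, abs_inv, abs_of_pos hw, inv_mul_le_iff₀ hw,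
    add_sub_add_left_eq_sub]
  refine h.trans (le_of_eq ?_)
  push_cast
  ring

/-- The Volterra equation of the Jost amplitudes has a bounded solution that is jointly continuous
in the spectral parameter and the position. -/
theorem exists_volterra_solution (hq : IsBargmannPotential q) :
    ∃ μ : ℝ≥0 × ℝ → ℝ, Continuous μ ∧ (∃ C, ∀ z, |μ z| ≤ C) ∧
      ∀ (κ : ℝ≥0) (x : ℝ), 0 ≤ x →
        μ (κ, x) = 1 + ∫ t, dampedRamp κ (max (t - x) 0) * (q t * μ (κ, t)) := by
  set n := hq.contracting_volterraMap.fixedPoint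
  have hn : hq.volterraMap n = n := hq.contracting_volterraMap.fixedPoint_isFixedPt
  refine ⟨fun z ↦ weight q z.2 * n z, (hq.continuous_weight.comp continuous_snd).mul n.continuous,
    ⟨Real.exp (2 * ∫ t, |t * q t|) * ‖n‖, fun z ↦ ?_⟩, fun κ x hx ↦ ?_⟩
  · rw [abs_mul, abs_of_pos (weight_pos q _)]
    gcongr
    · exact hq.weight_le _
    · exact n.norm_coe_le_norm z
  · have h : n (κ, x) = (weight q (max x 0))⁻¹ *
      (1 + ∫ t, dampedRamp κ (max (t - max x 0) 0) * (q t * (weight q t * n (κ, t)))) := by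
      conv_lhs => rw [← hn]
      rfl
    rw [max_eq_left hx] at h
    dsimp only
    rw [h, mul_inv_cancel_left₀ (weight_pos q x).ne']

end IsBargmannPotential

/-! ### Differentiating the Volterra equation -/

namespace IsBargmannPotential

variable {v : ℝ → ℝ}

/-- The function `1 + ∫ₓ^∞ D (t - x) v(t) dt`, with `D` the damped ramp. The cut-off `t > x` is
expressed through the positive part of `t - x`, which keeps the integrand continuous in `x`. -/
noncomputable def amplitude (κ : ℝ) (v : ℝ → ℝ) (x : ℝ) : ℝ :=
  1 + ∫ t, dampedRamp κ (max (t - x) 0) * v t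

/-- The derivative `-∫ₓ^∞ exp (-2κ(t - x)) v(t) dt` of the amplitude. -/
noncomputable def slope (κ : ℝ) (v : ℝ → ℝ) (x : ℝ) : ℝ :=
  -(Real.exp (2 * κ * x) * ∫ t in Ioi x, Real.exp (-(2 * κ * t)) * v t)

theorem abs_exp_mul_le (hv : IsBargmannPotential v) {κ : ℝ} (hκ : 0 ≤ κ) (t : ℝ) :
    |Real.exp (-(2 * κ * t)) * v t| ≤ |v t| := by
  rcases le_or_gt t 0 with h | h
  · simp [hv.eq_zero_of_nonpos t h]
  · rw [abs_mul, Real.abs_exp]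
    refine mul_le_of_le_one_left (abs_nonneg _) (Real.exp_le_one_iff.2 ?_)
    have := mul_nonneg hκ h.le
    linarith

theorem integrable_exp_mul (hv : IsBargmannPotential v) {κ : ℝ} (hκ : 0 ≤ κ) :
    Integrable fun t ↦ Real.exp (-(2 * κ * t)) * v t :=
  hv.integrable.abs.mono' ((by fun_prop : Continuous fun t : ℝ ↦
    Real.exp (-(2 * κ * t))).aestronglyMeasurable.mul hv.integrable.1)
    (Eventually.of_forall (hv.abs_exp_mul_le hκ))

theorem absolutelyContinuousOnInterval_slope (hv : IsBargmannPotential v) {κ : ℝ} (hκ : 0 ≤ κ)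
    (a b : ℝ) : AbsolutelyContinuousOnInterval (slope κ v) a b := by
  have h : ContDiff ℝ 1 fun x : ℝ ↦ Real.exp (2 * κ * x) := by fun_prop
  exact (h.contDiffOn.absolutelyContinuousOnInterval.fun_mul
    (absolutelyContinuousOnInterval_integral_Ioi (hv.integrable_exp_mul hκ) a b)).fun_neg

theorem continuous_slope (hv : IsBargmannPotential v) {κ : ℝ} (hκ : 0 ≤ κ) :
    Continuous (slope κ v) :=
  (Continuous.mul (by fun_prop) (continuous_integral_Ioi (hv.integrable_exp_mul hκ))).neg

theorem ae_hasDerivAt_slope (hv : IsBargmannPotential v) {κ : ℝ} (hκ : 0 ≤ κ) :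
    ∀ᵐ x, HasDerivAt (slope κ v) (2 * κ * slope κ v x + v x) x := by
  filter_upwards [ae_hasDerivAt_integral_Ioi (hv.integrable_exp_mul hκ)] with x hx
  have h1 : HasDerivAt (fun x : ℝ ↦ Real.exp (2 * κ * x)) (Real.exp (2 * κ * x) * (2 * κ)) x := by
    simpa using ((hasDerivAt_id x).const_mul (2 * κ)).exp
  convert! (h1.mul hx).neg using 1
  have h2 : Real.exp (2 * κ * x) * Real.exp (-(2 * κ * x)) = 1 := by
    rw [← Real.exp_add, add_neg_cancel, Real.exp_zero]
  unfold slope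
  linear_combination (-v x) * h2

theorem abs_slope_le (hv : IsBargmannPotential v) {κ : ℝ} (hκ : 0 ≤ κ) (x : ℝ) :
    |slope κ v x| ≤ ∫ t in Ioi x, |v t| := by
  rw [slope, abs_neg, ← integral_const_mul, ← Real.norm_eq_abs]
  refine norm_integral_le_of_norm_le hv.integrable.abs.integrableOn ?_
  filter_upwards [ae_restrict_mem measurableSet_Ioi] with t ht
  rw [← mul_assoc, ← Real.exp_add, Real.norm_eq_abs, abs_mul, Real.abs_exp]
  refine mul_le_of_le_one_left (abs_nonneg _) (Real.exp_le_one_iff.2 ?_)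
  have := mul_nonneg hκ (sub_nonneg.2 (le_of_lt ht))
  linarith

theorem integrable_ramp_mul (hv : IsBargmannPotential v) {κ : ℝ} (hκ : 0 ≤ κ) (x : ℝ) :
    Integrable fun t ↦ dampedRamp κ (max (t - x) 0) * v t := by
  have hD : Continuous fun t : ℝ ↦ dampedRamp κ (max (t - x) 0) :=
    continuous_dampedRamp.comp (by fun_prop : Continuous fun t : ℝ ↦ (κ, max (t - x) 0))
  refine (hv.integrable_abs_moment.add (hv.integrable.abs.const_mul |x|)).mono'
    (hD.aestronglyMeasurable.mul hv.integrable.1) (Eventually.of_forall fun t ↦ ?_)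
  have h0 := dampedRamp_nonneg κ (le_max_right (t - x) 0)
  have h1 := dampedRamp_le hκ (le_max_right (t - x) 0)
  have h2 : max (t - x) 0 ≤ |t| + |x| :=
    max_le ((le_abs_self _).trans (abs_sub t x)) (by positivity)
  rw [Real.norm_eq_abs, abs_mul, abs_of_nonneg h0, Pi.add_apply, abs_mul, ← add_mul]
  gcongr
  exact h1.trans h2

theorem hasDerivAt_amplitude (hv : IsBargmannPotential v) {κ : ℝ} (hκ : 0 ≤ κ) (x : ℝ) :
    HasDerivAt (amplitude κ v) (slope κ v x) x := by
  set F' : ℝ → ℝ := (Ioi x).indicator fun t ↦ -(Real.exp (-(2 * κ * (t - x))) * v t) with hF'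
  have h := (hasDerivAt_integral_of_dominated_loc_of_lip (μ := volume) (𝕜 := ℝ) (x₀ := x)
    (F := fun x t ↦ dampedRamp κ (max (t - x) 0) * v t) (F' := F') (bound := fun t ↦ |v t|)
    (s := univ) univ_mem
    (Eventually.of_forall fun y ↦ (hv.integrable_ramp_mul hκ y).1)
    (hv.integrable_ramp_mul hκ x) ?_ ?_ hv.integrable.abs ?_).2
  · convert! h.const_add 1 using 1
    rw [hF', integral_indicator measurableSet_Ioi, slope, integral_neg, ← integral_const_mul]
    congr 2
    ext t
    rw [← mul_assoc, ← Real.exp_add]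
    ring_nf
  · exact (((by fun_prop : Continuous fun t : ℝ ↦
      Real.exp (-(2 * κ * (t - x)))).aestronglyMeasurable.mul hv.integrable.1).neg).indicator
      measurableSet_Ioi
  · refine Eventually.of_forall fun t ↦ LipschitzOnWith.of_dist_le_mul fun y _ z _ ↦ ?_
    rw [Real.coe_nnabs, abs_abs, Real.dist_eq, Real.dist_eq, ← sub_mul, abs_mul, mul_comm]
    refine mul_le_mul_of_nonneg_left ?_ (abs_nonneg _)
    refine (dampedRamp_sub_le hκ (le_max_right _ _) (le_max_right _ _)).trans
      ((abs_max_sub_max_le_abs _ _ _).trans (le_of_eq ?_))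
    rw [abs_sub_comm y z]
    congr 1
    ring
  · filter_upwards [Measure.ae_ne volume x] with t ht
    rcases lt_or_gt_of_ne ht with h | h
    · rw [hF', indicator_of_notMem (by simpa using h.le)]
      refine (hasDerivAt_const x (0 : ℝ)).congr_of_eventuallyEq ?_
      filter_upwards [Ioi_mem_nhds h] with y hy
      rw [max_eq_right (sub_nonpos.2 (le_of_lt hy)), dampedRamp_zero, zero_mul]
    · rw [hF', indicator_of_mem (by simpa using h)]
      have h1 : HasDerivAt (fun y ↦ dampedRamp κ (t - y) * v t)
          (-(Real.exp (-(2 * κ * (t - x))) * v t)) x := by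
        convert! ((hasDerivAt_dampedRamp κ (t - x)).comp x
          ((hasDerivAt_id x).const_sub t)).mul_const (v t) using 1
        ring
      refine h1.congr_of_eventuallyEq ?_
      filter_upwards [Iio_mem_nhds h] with y hy
      rw [max_eq_left (sub_nonneg.2 (le_of_lt hy))]

/-- Smallness of the amplitude's deviation from `1` near infinity, uniformly in `κ`. -/
theorem abs_amplitude_sub_one_le (hv : IsBargmannPotential v) {κ x : ℝ} (hκ : 0 ≤ κ) (hx : 0 ≤ x) :
    |amplitude κ v x - 1| ≤ ∫ t in Ioi x, |t * v t| := by
  rw [amplitude, add_sub_cancel_left, ← integral_indicator measurableSet_Ioi, ← Real.norm_eq_abs]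
  refine norm_integral_le_of_norm_le (hv.integrable_abs_moment.indicator measurableSet_Ioi)
    (Eventually.of_forall fun t ↦ ?_)
  simpa using abs_kernel_le v hκ hx t 1

/-- Smallness of the amplitude's deviation from `1` for large `κ`, uniformly in `x`. -/
theorem two_mul_mul_abs_amplitude_sub_one_le (hv : IsBargmannPotential v) {κ : ℝ} (hκ : 0 ≤ κ)
    (x : ℝ) : 2 * κ * |amplitude κ v x - 1| ≤ ∫ t, |v t| := by
  have h2 : |2 * κ| = 2 * κ := abs_of_nonneg (by positivity)
  rw [amplitude, add_sub_cancel_left, ← h2, ← abs_mul, ← integral_const_mul, ← Real.norm_eq_abs]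
  refine norm_integral_le_of_norm_le hv.integrable.abs (Eventually.of_forall fun t ↦ ?_)
  have h0 := dampedRamp_nonneg κ (le_max_right (t - x) 0)
  rw [Real.norm_eq_abs, ← mul_assoc, abs_mul, abs_of_nonneg (by positivity)]
  exact mul_le_of_le_one_left (abs_nonneg _) (two_mul_mul_dampedRamp_le_one κ _)

end IsBargmannPotential

/-! ### The family of Jost solutions -/

/-- The family of Jost solutions of `f'' = (q + κ²) f` on the half-line, `κ ≥ 0`: `f = exp (-κx) m`
with the amplitude `m κ` tending to `1` at infinity, and `p κ` the derivative of `m κ`. The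
amplitude solves `m'' = 2κm' + qm`, and the family satisfies the listed uniform bounds. -/
structure IsJostFamily (q : ℝ → ℝ) (m p : ℝ≥0 → ℝ → ℝ) : Prop where
  continuous_amplitude : Continuous fun z : ℝ≥0 × ℝ ↦ m z.1 (max z.2 0)
  continuous_slope_zero : Continuous fun κ ↦ p κ 0
  continuous_slope : ∀ κ, Continuous (p κ)
  hasDerivAt : ∀ κ x, HasDerivAt (m κ) (p κ x) x
  absolutelyContinuous : ∀ κ a b, AbsolutelyContinuousOnInterval (p κ) a b
  ae_hasDerivAt : ∀ κ, ∀ᵐ x, HasDerivAt (p κ) (2 * κ * p κ x + q x * m κ x) x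
  bounded : ∃ C, ∀ κ, ∀ x, 0 ≤ x → |m κ x| ≤ C
  tendsto_one : ∀ ε > 0, ∃ R, 0 ≤ R ∧ ∀ κ x, R ≤ x → |m κ x - 1| ≤ ε
  tendsto_slope : ∀ κ, Tendsto (p κ) atTop (𝓝 0)
  large : ∃ K : ℝ≥0, 0 < K ∧ ∀ κ, K ≤ κ → (∀ x, 0 ≤ x → 0 < m κ x) ∧ p κ 0 < κ * m κ 0

open IsBargmannPotential in
/-- The solution `μ` of the Volterra equation makes `q μ(κ, ·)` a potential of the same kind, whose
amplitude agrees with `μ(κ, ·)` on the half-line and is differentiable on the whole line. -/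
theorem IsBargmannPotential.exists_isJostFamily {q : ℝ → ℝ} (hq : IsBargmannPotential q) :
    ∃ m p, IsJostFamily q m p := by
  obtain ⟨μ, hμ, ⟨C, hC⟩, heq⟩ := hq.exists_volterra_solution
  set v : ℝ≥0 → ℝ → ℝ := fun κ t ↦ q t * μ (κ, t) with hvdef
  have hC0 : 0 ≤ C := (abs_nonneg _).trans (hC 0)
  have hμκ (κ : ℝ≥0) : Continuous fun t ↦ μ (κ, t) := by fun_prop
  have hv (κ : ℝ≥0) : IsBargmannPotential (v κ) := by
    refine ⟨hq.integrable.mul_bdd (hμκ κ).aestronglyMeasurable (Eventually.of_forall fun t ↦ hC _),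
      ?_, fun t ht ↦ by simp [hvdef, hq.eq_zero_of_nonpos t ht]⟩
    simpa only [hvdef, mul_assoc] using hq.integrable_moment.mul_bdd (hμκ κ).aestronglyMeasurable
      (Eventually.of_forall fun t ↦ hC _)
  have hamp (κ : ℝ≥0) (x : ℝ) (hx : 0 ≤ x) : amplitude κ (v κ) x = μ (κ, x) := (heq κ x hx).symm
  have hvC (κ : ℝ≥0) (t : ℝ) : |v κ t| ≤ C * |q t| := by
    rw [hvdef, abs_mul, mul_comm]
    gcongr
    exact hC _
  set B : ℝ := C * ∫ t, |q t| with hB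
  have hvB (κ : ℝ≥0) : ∫ t, |v κ t| ≤ B := by
    rw [hB, ← integral_const_mul]
    exact integral_mono (hv κ).integrable.abs (hq.integrable.abs.const_mul C) (hvC κ)
  have hB0 : 0 ≤ B := mul_nonneg hC0 (integral_nonneg fun _ ↦ abs_nonneg _)
  refine ⟨fun κ ↦ amplitude κ (v κ), fun κ ↦ slope κ (v κ), ?_, ?_,
    fun κ ↦ (hv κ).continuous_slope κ.coe_nonneg, fun κ ↦ (hv κ).hasDerivAt_amplitude κ.coe_nonneg,
    fun κ ↦ (hv κ).absolutelyContinuousOnInterval_slope κ.coe_nonneg, ?_, ⟨C, fun κ x hx ↦ ?_⟩, ?_, ?_, ?_⟩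
  · refine Continuous.congr (f := fun z : ℝ≥0 × ℝ ↦ μ (z.1, max z.2 0)) (by fun_prop) fun z ↦ ?_
    rw [hamp _ _ (le_max_right _ _)]
  · simp only [slope, mul_zero, Real.exp_zero, one_mul]
    refine (continuous_of_dominated (bound := fun t ↦ C * |q t|)
      (fun κ ↦ ((hv κ).integrable_exp_mul κ.coe_nonneg).integrableOn.1)
      (fun κ ↦ Eventually.of_forall fun t ↦ ((hv κ).abs_exp_mul_le κ.coe_nonneg t).trans (hvC κ t))
      (hq.integrable.abs.const_mul C).integrableOn
      (Eventually.of_forall fun t ↦ ?_)).neg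
    simp only [hvdef]
    fun_prop
  · intro κ
    filter_upwards [(hv κ).ae_hasDerivAt_slope κ.coe_nonneg] with x hx
    -- on the negative half-line `μ` need not equal the amplitude, but there `q` vanishes
    have h : v κ x = q x * amplitude κ (v κ) x := by
      rcases le_or_gt x 0 with h | h
      · simp [hvdef, hq.eq_zero_of_nonpos x h]
      · rw [hamp κ x h.le]
    rwa [← h]
  · rw [hamp κ x hx]
    exact hC _
  · intro ε hε
    have hlim := (tendsto_integral_Ioi_atTop hq.integrable_abs_moment).const_mul C
    rw [mul_zero] at hlim
    obtain ⟨R, hR⟩ := eventually_atTop.1 ((hlim.eventually (gt_mem_nhds hε)).and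
      (eventually_ge_atTop 0))
    refine ⟨R, (hR R le_rfl).2, fun κ x hx ↦ ?_⟩
    refine ((hv κ).abs_amplitude_sub_one_le κ.coe_nonneg (hR x hx).2).trans (le_trans ?_ (hR x hx).1.le)
    rw [← integral_const_mul]
    refine integral_mono (hv κ).integrable_abs_moment.integrableOn
      (hq.integrable_abs_moment.const_mul C).integrableOn fun t ↦ ?_
    simp only [abs_mul t]
    rw [mul_left_comm]
    gcongr
    exact hvC κ t
  · intro κ
    exact squeeze_zero_norm (fun x ↦ (hv κ).abs_slope_le κ.coe_nonneg x)
      (tendsto_integral_Ioi_atTop (hv κ).integrable.abs)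
  · refine ⟨(2 * B + 1).toNNReal, Real.toNNReal_pos.2 (by positivity), fun κ hκ ↦ ?_⟩
    have hκ' : 2 * B + 1 ≤ κ := Real.toNNReal_le_iff_le_coe.1 hκ
    have h1 (x : ℝ) : 2 * κ * |amplitude κ (v κ) x - 1| ≤ B :=
      ((hv κ).two_mul_mul_abs_amplitude_sub_one_le κ.coe_nonneg x).trans (hvB κ)
    have h2 (x : ℝ) : κ - B / 2 ≤ κ * amplitude κ (v κ) x := by
      have := mul_le_mul_of_nonneg_left (neg_abs_le (amplitude κ (v κ) x - 1)) κ.coe_nonneg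
      have := h1 x
      nlinarith
    have hκ0 : (0 : ℝ) < κ := by linarith
    refine ⟨fun x _ ↦ pos_of_mul_pos_right (lt_of_lt_of_le (by linarith) (h2 x)) hκ0.le, ?_⟩
    have h3 : slope κ (v κ) 0 ≤ B := by
      refine (le_abs_self _).trans (((hv κ).abs_slope_le κ.coe_nonneg 0).trans (le_trans ?_ (hvB κ)))
      exact setIntegral_le_integral (hv κ).integrable.abs (Eventually.of_forall fun _ ↦ abs_nonneg _)
    linarith [h2 0]

/-! ### Positivity of the Jost solutions -/

theorem pos_of_continuous_of_ne_zero {g : ℝ≥0 → ℝ} (hg : Continuous g)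
    (h0 : ∀ κ, 0 < κ → g κ ≠ 0) {K : ℝ≥0} (hK : 0 < K) (hgK : 0 < g K) {κ : ℝ≥0} (hκ : 0 < κ) :
    0 < g κ := by
  by_contra! h
  obtain ⟨x, hx, hx0⟩ := isPreconnected_Ioi.intermediate_value (mem_Ioi.2 hκ) (mem_Ioi.2 hK)
    hg.continuousOn ⟨h, hgK.le⟩
  exact h0 x hx hx0

namespace IsJostFamily

variable {q : ℝ → ℝ} {m p : ℝ≥0 → ℝ → ℝ}

theorem continuous_amplitude_right (hj : IsJostFamily q m p) (κ : ℝ≥0) : Continuous (m κ) :=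
  continuous_iff_continuousAt.2 fun x ↦ (hj.hasDerivAt κ x).continuousAt

theorem continuous_amplitude_left (hj : IsJostFamily q m p) {x : ℝ} (hx : 0 ≤ x) :
    Continuous fun κ ↦ m κ x := by
  have := hj.continuous_amplitude.comp (by fun_prop : Continuous fun κ : ℝ≥0 ↦ (κ, x))
  simpa [Function.comp_def, max_eq_left hx] using this

/-- Uniqueness for the amplitude equation in the form of Grönwall's inequality for `m² + p²`: a
double zero would force the amplitude to vanish to its right, but it tends to `1`. -/
theorem slope_ne_zero_of_amplitude_eq_zero (hj : IsJostFamily q m p) (hq : Integrable q) {κ : ℝ≥0}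
    {a : ℝ} (hm : m κ a = 0) : p κ a ≠ 0 := by
  intro hp
  obtain ⟨R, -, hR⟩ := hj.tendsto_one (1 / 2) (by norm_num)
  set b := max a R
  -- `(m² + p²) w` is nonincreasing, as `(m² + p²)' ≤ (|q| + c) (m² + p²)` and `w' = -(|q| + c) w`
  have hab : a ≤ b := le_max_left _ _
  set c : ℝ := 1 + 4 * κ with hc
  set w : ℝ → ℝ := fun x ↦ Real.exp ((∫ t in Ioi x, |q t|) - c * x) with hw
  have hmac := absolutelyContinuousOnInterval_of_hasDerivAt (hj.hasDerivAt κ)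
    (hj.continuous_slope κ) a b
  have hpac := hj.absolutelyContinuous κ a b
  have hlin : AbsolutelyContinuousOnInterval (fun x : ℝ ↦ c * x) a b :=
    absolutelyContinuousOnInterval_of_hasDerivAt (f' := fun _ ↦ c)
      (fun x ↦ by simpa using (hasDerivAt_id x).const_mul c) continuous_const a b
  have hwac : AbsolutelyContinuousOnInterval w a b :=
    ((absolutelyContinuousOnInterval_integral_Ioi hq.abs a b).fun_sub hlin).exp
  have hle := (((hmac.fun_mul hmac).fun_add (hpac.fun_mul hpac)).fun_mul
    hwac).le_of_ae_hasDerivAt_nonpos hab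
    (f' := fun x ↦ (p κ x * m κ x + m κ x * p κ x + ((2 * κ * p κ x + q x * m κ x) * p κ x +
      p κ x * (2 * κ * p κ x + q x * m κ x))) * w x +
      (m κ x * m κ x + p κ x * p κ x) * (w x * (-|q x| - c)))
    (by
      filter_upwards [hj.ae_hasDerivAt κ, ae_hasDerivAt_integral_Ioi hq.abs] with x hx hx' _
      refine (((hj.hasDerivAt κ x).mul (hj.hasDerivAt κ x)).add (hx.mul hx)).mul ?_
      exact (hx'.sub (by simpa using (hasDerivAt_id x).const_mul c)).exp)
    (by
      intro x _
      have hwx : 0 < w x := Real.exp_pos _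
      have h1 : 2 * (m κ x * p κ x) ≤ m κ x ^ 2 + p κ x ^ 2 := by
        nlinarith [sq_nonneg (m κ x - p κ x)]
      have h2 : 2 * (q x * (m κ x * p κ x)) ≤ |q x| * (m κ x ^ 2 + p κ x ^ 2) := by
        have h3 : 2 * |m κ x * p κ x| ≤ m κ x ^ 2 + p κ x ^ 2 := by
          rw [abs_mul, ← sq_abs (m κ x), ← sq_abs (p κ x)]
          nlinarith [sq_nonneg (|m κ x| - |p κ x|)]
        have h4 := le_abs_self (q x * (m κ x * p κ x))
        rw [abs_mul] at h4
        nlinarith [mul_le_mul_of_nonneg_left h3 (abs_nonneg (q x))]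
      have h5 : 0 ≤ (κ : ℝ) * m κ x ^ 2 := mul_nonneg κ.coe_nonneg (sq_nonneg _)
      have h6 : (2 * (m κ x * p κ x) + 2 * (q x * (m κ x * p κ x)) + 4 * κ * p κ x ^ 2 -
          (|q x| + c) * (m κ x ^ 2 + p κ x ^ 2)) * w x ≤ 0 := by
        refine mul_nonpos_of_nonpos_of_nonneg ?_ hwx.le
        rw [hc]
        linarith
      linarith)
  simp only [hm, hp, mul_zero, add_zero, zero_mul] at hle
  have hE : m κ b * m κ b + p κ b * p κ b ≤ 0 := nonpos_of_mul_nonpos_left hle (Real.exp_pos _)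
  have hmb : m κ b = 0 := by nlinarith [mul_self_nonneg (m κ b), mul_self_nonneg (p κ b)]
  have := hR κ b (le_max_right _ _)
  rw [hmb] at this
  norm_num at this

/-- A nonnegative Jost solution `f = exp (-κx) m` with `f'(0) ≤ 0` has no zeros: a zero would be a
minimum of `m`, hence a double zero. -/
theorem amplitude_pos_of_nonneg (hj : IsJostFamily q m p) (hq : Integrable q) {κ : ℝ≥0}
    (hm : ∀ x, 0 ≤ x → 0 ≤ m κ x) (h0 : p κ 0 ≤ κ * m κ 0) {x : ℝ} (hx : 0 ≤ x) : 0 < m κ x := by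
  refine (hm x hx).lt_of_ne' fun h ↦ hj.slope_ne_zero_of_amplitude_eq_zero hq h ?_
  rcases hx.eq_or_lt with rfl | hx
  · rw [h, mul_zero] at h0
    refine h0.antisymm (ge_of_tendsto ((hasDerivWithinAt_iff_tendsto_slope' self_notMem_Ioi).1
      (hj.hasDerivAt κ 0).hasDerivWithinAt) ?_)
    filter_upwards [self_mem_nhdsWithin] with y hy
    rw [slope_def_field, h, sub_zero, sub_zero]
    exact div_nonneg (hm y (le_of_lt hy)) (le_of_lt hy)
  · refine IsLocalMin.hasDerivAt_eq_zero ?_ (hj.hasDerivAt κ x)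
    filter_upwards [Ioi_mem_nhds hx] with y hy
    rw [h]
    exact hm y (le_of_lt hy)

/-- If no Jost solution with `κ > 0` satisfies the Neumann condition, then all of them are positive:
the minimum of the amplitude over the half-line depends continuously on `κ`, is positive for large
`κ`, and cannot vanish. -/
theorem amplitude_pos_of_ne (hj : IsJostFamily q m p) (hq : Integrable q)
    (hne : ∀ κ : ℝ≥0, 0 < κ → p κ 0 ≠ κ * m κ 0) {κ : ℝ≥0} (hκ : 0 < κ) :
    p κ 0 < κ * m κ 0 ∧ ∀ x, 0 ≤ x → 0 < m κ x := by
  obtain ⟨K, hK, hlarge⟩ := hj.large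
  have hF {κ : ℝ≥0} (hκ : 0 < κ) : 0 < κ * m κ 0 - p κ 0 := by
    refine pos_of_continuous_of_ne_zero (g := fun κ : ℝ≥0 ↦ κ * m κ 0 - p κ 0)
      ((NNReal.continuous_coe.mul (hj.continuous_amplitude_left le_rfl)).sub
        hj.continuous_slope_zero) (fun κ hκ h ↦ hne κ hκ (sub_eq_zero.1 h).symm) hK
      (sub_pos.2 (hlarge K le_rfl).2) hκ
  refine ⟨sub_pos.1 (hF hκ), ?_⟩
  obtain ⟨R, hR0, hR⟩ := hj.tendsto_one (1 / 2) (by norm_num)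
  set M : ℝ≥0 → ℝ := fun κ ↦ sInf ((fun x ↦ m κ (max x 0)) '' Icc 0 R) with hM
  have hMc : Continuous M := isCompact_Icc.continuous_sInf hj.continuous_amplitude
  have hmin (κ : ℝ≥0) : ∃ x ∈ Icc 0 R, M κ = m κ x ∧ ∀ y ∈ Icc 0 R, m κ x ≤ m κ y := by
    obtain ⟨x, hx, hxM, hxm⟩ := isCompact_Icc.exists_sInf_image_eq_and_le (nonempty_Icc.2 hR0)
      ((hj.continuous_amplitude_right κ).comp (by fun_prop :
        Continuous fun x : ℝ ↦ max x 0)).continuousOn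
    refine ⟨x, hx, by simpa [hM, max_eq_left hx.1] using hxM, fun y hy ↦ ?_⟩
    simpa [max_eq_left hx.1, max_eq_left hy.1] using hxm y hy
  -- beyond `R` the amplitude is at least `1 / 2`, so its sign is decided on `[0, R]`
  have hpos {κ : ℝ≥0} {x : ℝ} (hx : R ≤ x) : 0 < m κ x := by
    linarith [(abs_le.1 (hR κ x hx)).1]
  have hMpos : 0 < M κ := by
    refine pos_of_continuous_of_ne_zero hMc (fun κ hκ h0 ↦ ?_) hK ?_ hκ
    · obtain ⟨x, hx, hxM, hxm⟩ := hmin κ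
      refine (hj.amplitude_pos_of_nonneg hq (fun y hy ↦ ?_) (sub_pos.1 (hF hκ)).le hx.1).ne'
        (hxM.symm.trans h0)
      rcases le_total y R with h | h
      · rw [← h0, hxM]
        exact hxm y ⟨hy, h⟩
      · exact (hpos h).le
    · obtain ⟨x, hx, hxM, -⟩ := hmin K
      rw [hxM]
      exact (hlarge K le_rfl).1 x hx.1
  obtain ⟨x, hx, hxM, hxm⟩ := hmin κ
  intro y hy
  rcases le_total y R with h | h
  · exact (hxM ▸ hMpos).trans_le (hxm y ⟨hy, h⟩)
  · exact hpos h

/-- The zero-energy Jost solution `m 0` cannot be positive with `m'(0) ≤ 0` unless the potential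
vanishes: `u = m'/m` solves the Riccati equation `u' = q - u²`, and integrating it over the half-line
gives `∫ u² = ∫ q + u(0) ≤ 0`. -/
theorem ae_eq_zero_of_amplitude_pos (hj : IsJostFamily q m p) (hq : Integrable q)
    (hq0 : ∫ t in Ioi 0, q t ≤ 0) (hm : ∀ x, 0 ≤ x → 0 < m 0 x) (hp : p 0 0 ≤ 0) :
    ∀ᵐ x, x ∈ Ioi 0 → q x = 0 := by
  set u : ℝ → ℝ := fun x ↦ p 0 x * (m 0 x)⁻¹ with hu
  have hmc := hj.continuous_amplitude_right 0
  have huc : ContinuousOn u (Ici 0) := (hj.continuous_slope 0).continuousOn.mul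
    (hmc.continuousOn.inv₀ fun x hx ↦ (hm x hx).ne')
  have hmC1 : ContDiff ℝ 1 (m 0) := contDiff_one_iff_deriv.2
    ⟨fun x ↦ (hj.hasDerivAt 0 x).differentiableAt, by
      rw [show deriv (m 0) = p 0 from funext fun x ↦ (hj.hasDerivAt 0 x).deriv]
      exact hj.continuous_slope 0⟩
  have hui {b : ℝ} (hb : 0 ≤ b) : IntervalIntegrable (fun x ↦ u x ^ 2) volume 0 b := by
    refine ContinuousOn.intervalIntegrable ((huc.pow 2).mono ?_)
    rw [uIcc_of_le hb]
    exact Icc_subset_Ici_self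
  have hric {b : ℝ} (hb : 0 ≤ b) :
      ∫ x in 0..b, u x ^ 2 = (∫ x in 0..b, q x) - (u b - u 0) := by
    have hinv : AbsolutelyContinuousOnInterval (fun x ↦ (m 0 x)⁻¹) 0 b := by
      refine (hmC1.contDiffOn.inv fun x hx ↦ (hm x ?_).ne').absolutelyContinuousOnInterval
      rw [uIcc_of_le hb] at hx
      exact hx.1
    have hac := (hj.absolutelyContinuous 0 0 b).fun_mul hinv
    rw [← hac.integral_eq_sub_of_ae_hasDerivAt (f' := fun x ↦ q x - u x ^ 2) hb,
      intervalIntegral.integral_sub hq.intervalIntegrable (hui hb)]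
    · ring
    · filter_upwards [hj.ae_hasDerivAt 0] with x hx hxb
      have hmx := (hm x hxb.1.le).ne'
      convert! hx.mul ((hj.hasDerivAt 0 x).inv hmx) using 1
      simp only [hu, NNReal.coe_zero, Pi.inv_apply]
      field_simp
      ring
  have hulim : Tendsto u atTop (𝓝 0) := by
    have h1 : Tendsto (m 0) atTop (𝓝 1) := by
      refine Metric.tendsto_atTop.2 fun ε hε ↦ ?_
      obtain ⟨R, -, hR⟩ := hj.tendsto_one (ε / 2) (by positivity)
      exact ⟨R, fun x hx ↦ (hR 0 x hx).trans_lt (by linarith)⟩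
    simpa using (hj.tendsto_slope 0).mul (h1.inv₀ one_ne_zero)
  have hu0 : u 0 ≤ 0 := mul_nonpos_of_nonpos_of_nonneg hp (inv_nonneg.2 (hm 0 le_rfl).le)
  have hlim : Tendsto (fun b ↦ ∫ x in 0..b, u x ^ 2) atTop (𝓝 ((∫ t in Ioi 0, q t) - (0 - u 0))) := by
    refine Tendsto.congr' ?_ ((intervalIntegral_tendsto_integral_Ioi 0 hq.integrableOn
      tendsto_id).sub (hulim.sub_const (u 0)))
    filter_upwards [eventually_ge_atTop 0] with b hb using (hric hb).symm
  have hint {b : ℝ} (hb : 0 ≤ b) : ∫ x in 0..b, u x ^ 2 ≤ 0 := by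
    refine (ge_of_tendsto hlim ?_).trans (by linarith)
    filter_upwards [eventually_ge_atTop b] with c hc
    refine intervalIntegral.integral_mono_interval le_rfl hb hc
      (Eventually.of_forall fun x ↦ sq_nonneg _) (hui (hb.trans hc))
  have huz {x : ℝ} (hx : 0 < x) : u x = 0 := by
    by_contra hne
    refine (hint hx.le).not_gt (intervalIntegral.integral_pos hx
      ((huc.pow 2).mono Icc_subset_Ici_self) (fun _ _ ↦ sq_nonneg _)
      ⟨x, right_mem_Icc.2 hx.le, by positivity⟩)
  have hpz {x : ℝ} (hx : 0 < x) : p 0 x = 0 := by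
    simpa [hu, (hm x hx.le).ne'] using huz hx
  filter_upwards [hj.ae_hasDerivAt 0] with x hx hx0
  have h0 : HasDerivAt (p 0) 0 x := (hasDerivAt_const x (0 : ℝ)).congr_of_eventuallyEq
    (eventually_of_mem (Ioi_mem_nhds hx0) fun y hy ↦ hpz hy)
  have := hx.unique h0
  simpa [hpz hx0, (hm x (le_of_lt hx0)).ne'] using this

/-- Some Jost solution with `κ > 0` satisfies the Neumann condition `f'(0) = p - κm = 0`. -/
theorem exists_neumann (hj : IsJostFamily q m p) (hq : Integrable q)
    (hq0 : ∫ t in Ioi 0, q t ≤ 0) (hqne : ¬ ∀ᵐ x, x ∈ Ioi 0 → q x = 0) :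
    ∃ κ : ℝ≥0, 0 < κ ∧ p κ 0 = κ * m κ 0 := by
  by_contra! hne
  have hev : ∀ᶠ κ : ℝ≥0 in 𝓝[>] 0, p κ 0 < κ * m κ 0 ∧ ∀ x, 0 ≤ x → 0 < m κ x := by
    filter_upwards [self_mem_nhdsWithin] with κ hκ using hj.amplitude_pos_of_ne hq hne hκ
  have hm0 : ∀ x, 0 ≤ x → 0 ≤ m 0 x := fun x hx ↦
    ge_of_tendsto ((hj.continuous_amplitude_left hx).tendsto 0 |>.mono_left nhdsWithin_le_nhds)
      (hev.mono fun κ hκ ↦ (hκ.2 x hx).le)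
  have hp0 : p 0 0 ≤ (0 : ℝ≥0) * m 0 0 :=
    le_of_tendsto_of_tendsto
      (hj.continuous_slope_zero.tendsto 0 |>.mono_left nhdsWithin_le_nhds)
      ((NNReal.continuous_coe.mul (hj.continuous_amplitude_left le_rfl)).tendsto 0
        |>.mono_left nhdsWithin_le_nhds) (hev.mono fun κ hκ ↦ hκ.1.le)
  exact hqne (hj.ae_eq_zero_of_amplitude_pos hq hq0
    (fun x hx ↦ hj.amplitude_pos_of_nonneg hq hm0 hp0 hx) (by simpa using hp0))

end IsJostFamily

/-! ### The eigenfunction -/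

theorem isBargmannPotential_indicator {V : ℝ → ℝ} (hV : IntegrableOn V (Ioi 0))
    (hV' : IntegrableOn (fun x ↦ x * |V x|) (Ioi 0)) (c : ℝ) :
    IsBargmannPotential ((Ioi 0).indicator fun t ↦ c * V t) := by
  refine ⟨(integrable_indicator_iff measurableSet_Ioi).2 (hV.const_mul c), ?_,
    fun t ht ↦ indicator_of_notMem (by simpa using ht) _⟩
  have h : IntegrableOn (fun x ↦ x * (c * V x)) (Ioi 0) := by
    refine (hV'.const_mul |c|).mono' (measurable_id.aestronglyMeasurable.mul (hV.1.const_mul c)) ?_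
    filter_upwards [ae_restrict_mem measurableSet_Ioi] with x hx
    rw [Real.norm_eq_abs, abs_mul, abs_mul, abs_of_pos (mem_Ioi.1 hx)]
    exact le_of_eq (by ring)
  refine ((integrable_indicator_iff measurableSet_Ioi).2 h).congr (Eventually.of_forall fun x ↦ ?_)
  by_cases hx : x ∈ Ioi (0 : ℝ) <;> simp [hx]

theorem memLp_ofReal_exp_mul {m : ℝ → ℝ} (hm : Continuous m) {C : ℝ}
    (hC : ∀ x, 0 ≤ x → |m x| ≤ C) {κ : ℝ} (hκ : 0 < κ) :
    MemLp (fun x ↦ ((Real.exp (-(κ * x)) * m x : ℝ) : ℂ)) 2 HalfLine.halfLineMeasure := by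
  have hc : Continuous fun x ↦ ((Real.exp (-(κ * x)) * m x : ℝ) : ℂ) := by fun_prop
  rw [memLp_two_iff_integrable_sq_norm hc.aestronglyMeasurable]
  refine ((integrableOn_exp_mul_Ioi (a := -(2 * κ)) (by linarith) 0).const_mul (C ^ 2)).mono'
    (hc.norm.pow 2).aestronglyMeasurable ?_
  filter_upwards [ae_restrict_mem measurableSet_Ioi] with x hx
  rw [norm_pow, norm_norm, Complex.norm_real, Real.norm_eq_abs, abs_mul, Real.abs_exp, mul_pow,
    ← Real.exp_nat_mul, mul_comm]
  have h : ((2 : ℕ) : ℝ) * -(κ * x) = -(2 * κ) * x := by push_cast; ring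
  rw [h]
  gcongr
  exact hC x (le_of_lt hx)

/-- A Jost solution with `κ > 0` that satisfies the Neumann condition is an eigenfunction for the
eigenvalue `-κ²`. -/
theorem IsJostFamily.isEigenvalue {V : ℝ → ℝ} {σ : ℝ} {m p : ℝ≥0 → ℝ → ℝ}
    (hj : IsJostFamily ((Ioi 0).indicator fun t ↦ -σ * V t) m p) {κ : ℝ≥0} (hκ : 0 < κ)
    (h0 : p κ 0 = κ * m κ 0) :
    HalfLine.IsEigenvalue (HalfLine.neumannOperator V σ) ((-(κ : ℝ) ^ 2 : ℝ) : ℂ) := by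
  set q : ℝ → ℝ := (Ioi 0).indicator fun t ↦ -σ * V t with hq
  obtain ⟨C, hC⟩ := hj.bounded
  have hL := memLp_ofReal_exp_mul (hj.continuous_amplitude_right κ) (hC κ) (NNReal.coe_pos.2 hκ)
  have hexp (x : ℝ) : HasDerivAt (fun x : ℝ ↦ Real.exp (-(κ * x))) (Real.exp (-(κ * x)) * -κ) x := by
    simpa using ((hasDerivAt_id x).const_mul (κ : ℝ)).neg.exp
  set f : HalfLine.L2 := hL.toLp _ with hf
  have hfe := hL.coeFn_toLp
  have hpair : HalfLine.IsSchrodingerPair V σ f (((-(κ : ℝ) ^ 2 : ℝ) : ℂ) • f) := by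
    refine ⟨fun x ↦ ((Real.exp (-(κ * x)) * m κ x : ℝ) : ℂ),
      fun x ↦ ((Real.exp (-(κ * x)) * (p κ x - κ * m κ x) : ℝ) : ℂ),
      fun x ↦ ((Real.exp (-(κ * x)) * ((q x + κ ^ 2) * m κ x) : ℝ) : ℂ),
      hfe, fun x _ ↦ HasDerivAt.hasDerivWithinAt (HasDerivAt.ofReal_comp ?_), fun b _ ↦ ?_, ?_,
      ae_restrict_of_ae ?_, ?_⟩
    · convert! (hexp x).mul (hj.hasDerivAt κ x) using 1
      ring
    · refine (Complex.isometry_ofReal.lipschitz.lipschitzOnWith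
        (s := univ)).comp_absolutelyContinuousOnInterval ?_ (mapsTo_univ _ _)
      have hE : ContDiff ℝ 1 fun x : ℝ ↦ Real.exp (-(κ * x)) := by fun_prop
      exact hE.contDiffOn.absolutelyContinuousOnInterval.fun_mul
        ((hj.absolutelyContinuous κ 0 b).fun_sub ((absolutelyContinuousOnInterval_of_hasDerivAt
          (hj.hasDerivAt κ) (hj.continuous_slope κ) 0 b).const_mul κ))
    · simp [h0]
    · filter_upwards [hj.ae_hasDerivAt κ] with x hx
      refine HasDerivAt.ofReal_comp ?_
      convert! (hexp x).mul (hx.sub ((hj.hasDerivAt κ x).const_mul (κ : ℝ))) using 1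
      simp only [Pi.sub_apply]
      ring
    · filter_upwards [hfe, Lp.coeFn_smul (((-(κ : ℝ) ^ 2 : ℝ) : ℂ)) f,
        ae_restrict_mem measurableSet_Ioi] with x hx hx' hx0
      rw [hx', Pi.smul_apply, hf, hx, hq, indicator_of_mem hx0]
      push_cast
      rw [smul_eq_mul]
      ring
  obtain ⟨y, hy, hTy⟩ := (LinearPMap.mem_graph_iff _).1
    ((HalfLine.mem_graph_neumannOperator V σ _ _).2 hpair)
  dsimp only at hy hTy
  refine ⟨y, fun hy0 ↦ ?_, by rw [hTy, hy]⟩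
  -- the continuous representative would vanish on `(0, ∞)`, whereas `m` tends to `1`
  obtain ⟨R, hR0, hR⟩ := hj.tendsto_one (1 / 2) (by norm_num)
  have hae : ∀ᵐ x ∂HalfLine.halfLineMeasure, m κ x = (0 : ℝ → ℝ) x := by
    have hf0 := Lp.coeFn_zero ℂ 2 HalfLine.halfLineMeasure
    rw [← hy0, hy] at hf0
    filter_upwards [hf0, hfe] with x hx hx'
    have h := hx'.symm.trans hx
    simpa [Real.exp_ne_zero] using h
  have hz := Measure.eqOn_open_of_ae_eq hae isOpen_Ioi
    (hj.continuous_amplitude_right κ).continuousOn continuousOn_const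
  have := hR κ (R + 1) (by linarith)
  rw [hz (show R + 1 ∈ Ioi (0 : ℝ) from by simp; linarith)] at this
  norm_num at this

theorem mainTheorem3 (V : ℝ → ℝ)
    (hVint : MeasureTheory.IntegrableOn V (Set.Ioi 0))
    (hVbargmann : MeasureTheory.IntegrableOn (fun x : ℝ => x * |V x|) (Set.Ioi 0))
    (hVne : ¬ (∀ᵐ x ∂HalfLine.halfLineMeasure, V x = 0))
    (hVnonneg : 0 ≤ ∫ x in Set.Ioi (0 : ℝ), V x)
    (σ : ℝ) (hσ : 0 < σ) :
    ∃ l : ℝ, l < 0 ∧ HalfLine.IsEigenvalue (HalfLine.neumannOperator V σ) (l : ℂ) := by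
  have hq := isBargmannPotential_indicator hVint hVbargmann (-σ)
  obtain ⟨m, p, hj⟩ := hq.exists_isJostFamily
  obtain ⟨κ, hκ, h0⟩ := hj.exists_neumann hq.integrable
    (by
      rw [setIntegral_indicator measurableSet_Ioi, inter_self, integral_const_mul]
      exact mul_nonpos_of_nonpos_of_nonneg (neg_nonpos.2 hσ.le) hVnonneg)
    (fun h ↦ hVne <| (ae_restrict_iff' measurableSet_Ioi).2 <| h.mono fun x hx hx0 ↦ by
      have := hx hx0
      rw [indicator_of_mem hx0] at this
      exact (mul_eq_zero.1 this).resolve_left (neg_ne_zero.2 hσ.ne'))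
  exact ⟨-(κ : ℝ) ^ 2, neg_neg_of_pos (pow_pos (NNReal.coe_pos.2 hκ) 2), hj.isEigenvalue hκ h0⟩
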